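/- Let $$B=\frac{\mathbb{C}[x_{\epsilon_1+\epsilon_2},x_{\epsilon_1-\epsilon_2},x_{\epsilon_2},x_{\epsilon_1}]}{\left(x_{\epsilon_1+\epsilon_2}^2,\; x_{\epsilon_1-\epsilon_2}^2,\; x_{\epsilon_1}^2,\; x_{\epsilon_2}x_{\epsilon_1+\epsilon_2},\; x_{\epsilon_1}x_{\epsilon_1-\epsilon_2},\; x_{\epsilon_1}x_{\epsilon_1+\epsilon_2},\; x_{\epsilon_2}^3,\; x_{\epsilon_2}^2x_{\epsilon_1}\right)},$$ where the four generators are independent variables. Let $J_\infty(B)$ be its infinite jet algebra, that is, the quotient of the polynomial ring $\mathbb{C}[x_{j,(-1-i)} \mid j\in\{\epsilon_1+\epsilon_2,\epsilon_1-\epsilon_2,\epsilon_2,\epsilon_1\},\ i\ge 0]$ by the ideal generated by all $T^k f$, where $k\ge 0$, $f$ runs over the eight listed relations with $x_j$ identified with $x_{j,(-1)}$, and $T$ is the $\mathbb{C}$-linear derivation with $T x_{j,(-1-i)}=(-1-i)\,x_{j,(-2-i)}$. Grade $J_\infty(B)$ by giving $x_{j,(-1-i)}$ weight $i+1$. Then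 every homogeneous component $J_\infty(B)_{(m)}$ is finite dimensional, and the Hilbert series $HS_q(J_\infty(B))=\sum_{m\ge 0}\dim\left(J_\infty(B)_{(m)}\right)q^m$ is coefficientwise less than or equal to the formal power series $$\sum_{n_1,n_2,n_3,n_4,n_5\ge 0}\frac{q^{\,n_1^2+n_2^2+(n_3+n_5)^2+n_4^2+n_3^2+(2n_3+n_5)n_1+n_4(n_1+n_2)+n_3n_4}}{(q)_{n_1}(q)_{n_2}(q)_{n_3}(q)_{n_4}(q)_{n_5}},\qquad (q)_n=\prod_{i=1}^{n}(1-q^i).$$ -/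

import Mathlib

/-! ### Infinite jet algebras and their Hilbert series -/

namespace JetB2

/-- The polynomial ring `ℂ[x_{j,(-1-i)} | j ∈ σ, i ≥ 0]`;
the variable `x_{j,(-1-i)}` is `MvPolynomial.X (j, i)`. -/
abbrev JetPoly (σ : Type*) : Type _ := MvPolynomial (σ × ℕ) ℂ

/-- The derivation `T` with `T x_{j,(-1-i)} = (-1-i) x_{j,(-2-i)}`. -/
noncomputable def jetT (σ : Type*) : Derivation ℂ (JetPoly σ) (JetPoly σ) :=
  MvPolynomial.mkDerivation ℂ
    (fun p : σ × ℕ => (-1 - (p.2 : ℂ)) • (MvPolynomial.X (p.1, p.2 + 1) : JetPoly σ))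

/-- The identification of `x_j` with `x_{j,(-1)}`. -/
noncomputable def jetIncl (σ : Type*) : MvPolynomial σ ℂ →ₐ[ℂ] JetPoly σ :=
  MvPolynomial.rename (fun j => (j, 0))

/-- The ideal `(f | f ∈ S)_∂ = (T^k f | f ∈ S, k ≥ 0)`. -/
noncomputable def jetIdeal {σ : Type*} (S : Set (MvPolynomial σ ℂ)) : Ideal (JetPoly σ) :=
  Ideal.span {g | ∃ f ∈ S, ∃ k : ℕ, g = (⇑(jetT σ))^[k] (jetIncl σ f)}

/-- The infinite jet algebra of `ℂ[x_j | j ∈ σ] / (S)`. -/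
abbrev JetAlgebra {σ : Type*} (S : Set (MvPolynomial σ ℂ)) : Type _ :=
  JetPoly σ ⧸ jetIdeal S

/-- The component of weight `m` of the infinite jet algebra, where each `x_j` has weight `1`,
so that `x_{j,(-1-i)}` has weight `i + 1`: the image of the polynomials of weight `m`. -/
noncomputable def jetGraded {σ : Type*} (S : Set (MvPolynomial σ ℂ)) (m : ℕ) :
    Submodule ℂ (JetAlgebra S) :=
  (MvPolynomial.weightedHomogeneousSubmodule ℂ (fun p : σ × ℕ => p.2 + 1) m).map
    (Ideal.Quotient.mkₐ ℂ (jetIdeal S)).toLinearMap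

/-- The Hilbert series `∑ m, dim (J_∞)_(m) q^m`. -/
noncomputable def jetHilbertSeries {σ : Type*} (S : Set (MvPolynomial σ ℂ)) : PowerSeries ℚ :=
  PowerSeries.mk fun m => (Module.finrank ℂ (jetGraded S m) : ℚ)

/-! ### The algebra `B` -/

/-- The variable `x_{ε₁+ε₂}`. -/
noncomputable abbrev xPlus : MvPolynomial (Fin 4) ℂ := MvPolynomial.X 0
/-- The variable `x_{ε₁-ε₂}`. -/
noncomputable abbrev xMinus : MvPolynomial (Fin 4) ℂ := MvPolynomial.X 1
/-- The variable `x_{ε₂}`. -/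
noncomputable abbrev xTwo : MvPolynomial (Fin 4) ℂ := MvPolynomial.X 2
/-- The variable `x_{ε₁}`. -/
noncomputable abbrev xOne : MvPolynomial (Fin 4) ℂ := MvPolynomial.X 3

/-- The defining relations of `B = ℂ[x_{ε₁+ε₂}, x_{ε₁-ε₂}, x_{ε₂}, x_{ε₁}] / (relB)`. -/
noncomputable def relB : Set (MvPolynomial (Fin 4) ℂ) :=
  {xPlus ^ 2, xMinus ^ 2, xOne ^ 2, xTwo * xPlus, xOne * xMinus, xOne * xPlus,
    xTwo ^ 3, xTwo ^ 2 * xOne}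

/-! ### The fermionic sum -/

/-- `(q)_n = (1 - q)(1 - q²)⋯(1 - qⁿ)`. -/
noncomputable def qPoch (n : ℕ) : PowerSeries ℚ :=
  ∏ i ∈ Finset.range n, (1 - PowerSeries.X ^ (i + 1))

/-- The exponent of `q`, with `(n 0, …, n 4) = (n₁, …, n₅)`. -/
def fermExp (n : Fin 5 → ℕ) : ℕ :=
  n 0 ^ 2 + n 1 ^ 2 + (n 2 + n 4) ^ 2 + n 3 ^ 2 + n 2 ^ 2 + (2 * n 2 + n 4) * n 0
    + n 3 * (n 0 + n 1) + n 2 * n 3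

/-- The summand `q^{fermExp n} / ((q)_{n₁} ⋯ (q)_{n₅})`. The inverse is the one of formal power
series; each `(q)_k` has constant coefficient `1`. -/
noncomputable def fermTerm (n : Fin 5 → ℕ) : PowerSeries ℚ :=
  PowerSeries.X ^ fermExp n * ∏ k : Fin 5, (qPoch (n k))⁻¹

/-- The 5-fold sum as a formal power series. For each power of `q` only finitely many summands
contribute (`fermTerm_support_finite`), so that the coefficientwise sum is a finite one. -/
noncomputable def fermSum : PowerSeries ℚ :=
  PowerSeries.mk fun m => ∑ᶠ n : Fin 5 → ℕ, PowerSeries.coeff m (fermTerm n)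

theorem qPoch_mul_inv (n : ℕ) : qPoch n * (qPoch n)⁻¹ = 1 := by
  apply PowerSeries.mul_inv_cancel
  simp [qPoch, map_prod]

theorem fermTerm_support_finite (m : ℕ) :
    (Function.support fun n : Fin 5 → ℕ => PowerSeries.coeff m (fermTerm n)).Finite := by
  refine (Set.finite_Iic (fun _ : Fin 5 => m)).subset ?_
  intro n hn
  have hle : fermExp n ≤ m := by
    by_contra hlt
    apply hn
    simp [fermTerm, PowerSeries.coeff_X_pow_mul', hlt]
  unfold fermExp at hle
  intro k
  have key : n k ≤ n k ^ 2 := Nat.le_self_pow two_ne_zero _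
  have h4 : n 4 ^ 2 ≤ (n 2 + n 4) ^ 2 := Nat.pow_le_pow_left (Nat.le_add_left _ _) 2
  fin_cases k <;> simp at key ⊢ <;> omega

end JetB2

/-! An upper bound only needs a spanning set of the right size, and it is found by duality: a linear
functional `φ` killing the candidates must kill the whole component of weight `m`
(`jetGraded_le_span`).

Up to nonzero scalars, the generators of the jet ideal are the coefficients of the relations
evaluated at the series x_j(t), so these series satisfy the relations of B. Allow x_{ε₂}(t)² as a
fifth kind of factor. For a family of factors, the values of `φ` on products of coefficients form a
polynomial `corr` with one variable t_i per factor. The relations and their derivatives make it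
divisible by powers of t_j - t_i, with exponents from `kindMult`. The exception is a pair of single
factors x_{ε₂}: on the diagonal they merge into a factor x_{ε₂}², and `φ` vanishes there by
induction on the number of single factors x_{ε₂} (`vanishesOn_kindSeries`).

Hence `diffProd` divides `corr`. By symmetry among factors of one kind, the lex leading exponent of
a nonzero `corr` is `leadExp` plus an exponent weakly decreasing along each kind
(`exists_lexDegree_eq`). Its coefficient is the value of `φ` on a candidate, which is zero, so
`corr` vanishes (`corr_eq_zero`).

Weakly decreasing sequences of length n_k are partitions, counted by 1/(q)_{n_k}; the degree of
`diffProd` plus the weights of the factors is `fermExp` (`sum_leadExp_add`). This gives the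
fermionic sum. -/

namespace JetB2

/-! ### Jet relations as identities of generating series -/

section Jet

variable {σ : Type*}

/-- The generating series `f(x(t))` where `x_j(t) = ∑ n, x_{j,(-1-n)} t^n`. -/
noncomputable def jetSeries (σ : Type*) : MvPolynomial σ ℂ →ₐ[ℂ] PowerSeries (JetPoly σ) :=
  MvPolynomial.aeval fun j => PowerSeries.mk fun n => MvPolynomial.X (j, n)

/-- The derivation `T` applied to the coefficients of a power series. -/
noncomputable def jetTSeries (f : PowerSeries (JetPoly σ)) : PowerSeries (JetPoly σ) :=
  PowerSeries.mk fun n => jetT σ (PowerSeries.coeff n f)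

theorem jetTSeries_mul (f g : PowerSeries (JetPoly σ)) :
    jetTSeries (f * g) = f * jetTSeries g + g * jetTSeries f := by
  ext1 n
  rw [map_add, mul_comm g]
  simp only [jetTSeries, PowerSeries.coeff_mk, PowerSeries.coeff_mul, map_sum,
    Derivation.leibniz, Finset.sum_add_distrib, smul_eq_mul]
  congr 1
  exact Finset.sum_congr rfl fun p _ => mul_comm _ _

/-- Both operations obey the Leibniz rule, so it is enough to compare them on constants and
variables, where T x_{j,(-1-n)} = -(n+1) x_{j,(-2-n)} is exactly the action of -d/dt. -/
theorem jetTSeries_jetSeries (f : MvPolynomial σ ℂ) :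
    jetTSeries (jetSeries σ f) = -PowerSeries.derivative (JetPoly σ) (jetSeries σ f) := by
  induction f using MvPolynomial.induction_on with
  | C a =>
    have h : jetSeries σ (MvPolynomial.C a) = PowerSeries.C (MvPolynomial.C a) := by
      rw [jetSeries, MvPolynomial.aeval_C, PowerSeries.algebraMap_apply, MvPolynomial.algebraMap_eq]
    rw [h, PowerSeries.derivative_C, neg_zero]
    ext1 n
    simp only [jetTSeries, PowerSeries.coeff_mk, PowerSeries.coeff_C, map_zero]
    split_ifs
    · exact (jetT σ).map_algebraMap a
    · simp
  | add p q hp hq =>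
    rw [map_add, map_add, neg_add, ← hp, ← hq]
    ext1 n
    simp [jetTSeries]
  | mul_X p j hp =>
    have hX : jetTSeries (jetSeries σ (MvPolynomial.X j)) =
        -PowerSeries.derivative (JetPoly σ) (jetSeries σ (MvPolynomial.X j)) := by
      ext1 n
      rw [map_neg, PowerSeries.coeff_derivative]
      simp only [jetTSeries, jetSeries, MvPolynomial.aeval_X, PowerSeries.coeff_mk, jetT,
        MvPolynomial.mkDerivation_X, MvPolynomial.smul_eq_C_mul]
      simp
      ring
    rw [map_mul, jetTSeries_mul, Derivation.leibniz, hp, hX]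
    simp only [smul_eq_mul]
    ring

theorem constantCoeff_jetSeries (f : MvPolynomial σ ℂ) :
    PowerSeries.constantCoeff (jetSeries σ f) = jetIncl σ f := by
  induction f using MvPolynomial.induction_on with
  | C a =>
    have h : jetSeries σ (MvPolynomial.C a) = PowerSeries.C (MvPolynomial.C a) := by
      rw [jetSeries, MvPolynomial.aeval_C, PowerSeries.algebraMap_apply, MvPolynomial.algebraMap_eq]
    simp [h, jetIncl]
  | add p q hp hq => simp [hp, hq]
  | mul_X p j hp =>
    rw [map_mul, map_mul, hp]
    simp [jetSeries, jetIncl]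

theorem iterate_jetT (f : MvPolynomial σ ℂ) (k : ℕ) :
    (jetT σ)^[k] (jetIncl σ f) =
      ((-1) ^ k * (k.factorial : ℂ)) • PowerSeries.coeff k (jetSeries σ f) := by
  induction k with
  | zero => simp [← constantCoeff_jetSeries]
  | succ k ih =>
    have h := congrArg (PowerSeries.coeff k) (jetTSeries_jetSeries f)
    rw [map_neg, PowerSeries.coeff_derivative] at h
    simp only [jetTSeries, PowerSeries.coeff_mk] at h
    rw [Function.iterate_succ_apply', ih, Derivation.map_smul, h, Nat.factorial_succ]
    simp only [MvPolynomial.smul_eq_C_mul]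
    simp
    ring

/-- The coefficient differs from a generator of the ideal by the scalar (-1)^k k!, which is
invertible over ℂ. -/
theorem coeff_jetSeries_mem (S : Set (MvPolynomial σ ℂ)) {f : MvPolynomial σ ℂ} (hf : f ∈ S)
    (k : ℕ) : PowerSeries.coeff k (jetSeries σ f) ∈ jetIdeal S := by
  have h0 : ((-1) ^ k * (k.factorial : ℂ)) ≠ 0 := by
    simp [Nat.factorial_ne_zero]
  have h : PowerSeries.coeff k (jetSeries σ f) =
      MvPolynomial.C ((-1) ^ k * (k.factorial : ℂ))⁻¹ * (jetT σ)^[k] (jetIncl σ f) := by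
    rw [iterate_jetT, ← MvPolynomial.smul_eq_C_mul, smul_smul, inv_mul_cancel₀ h0, one_smul]
  rw [h]
  exact Ideal.mul_mem_left _ _ (Ideal.subset_span ⟨f, hf, k, rfl⟩)

/-- The generating series of the classes of the `x_{j,(-1-n)}` in the jet algebra. -/
noncomputable def genSeries (S : Set (MvPolynomial σ ℂ)) (j : σ) : PowerSeries (JetAlgebra S) :=
  PowerSeries.mk fun n => Ideal.Quotient.mk (jetIdeal S) (MvPolynomial.X (j, n))

theorem aeval_genSeries (S : Set (MvPolynomial σ ℂ)) {f : MvPolynomial σ ℂ} (hf : f ∈ S) :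
    MvPolynomial.aeval (genSeries S) f = 0 := by
  have h : MvPolynomial.aeval (genSeries S) =
      (PowerSeries.mapAlgHom (Ideal.Quotient.mkₐ ℂ (jetIdeal S))).comp (jetSeries σ) := by
    ext j n
    simp [genSeries, jetSeries, PowerSeries.mapAlgHom_apply]
  rw [h]
  ext n
  simpa [PowerSeries.mapAlgHom_apply] using Ideal.Quotient.eq_zero_iff_mem.2 (coeff_jetSeries_mem S hf n)

end Jet

/-! ### Divisibility by powers of a difference of variables -/

section Divisibility

open MvPolynomial

variable {ι R : Type*} [CommRing R]

theorem iterate_pderiv_X_sub_X_mul {i j : ι} (hij : i ≠ j) (G : MvPolynomial ι R) (s : ℕ) :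
    (pderiv j)^[s + 1] ((X j - X i) * G) =
      (X j - X i) * (pderiv j)^[s + 1] G + (s + 1 : MvPolynomial ι R) * (pderiv j)^[s] G := by
  have h1 : pderiv j (X j - X i : MvPolynomial ι R) = 1 := by
    rw [map_sub, pderiv_X_self, pderiv_X_of_ne hij, sub_zero]
  induction s with
  | zero =>
    simp only [zero_add, Function.iterate_one, Function.iterate_zero, id, Nat.cast_zero, one_mul]
    rw [pderiv_mul, h1]
    ring
  | succ s ih =>
    have h2 : pderiv j ((s : MvPolynomial ι R) + 1) = 0 := by simp
    rw [Function.iterate_succ_apply', ih, map_add, pderiv_mul, pderiv_mul, h1, h2,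
      ← Function.iterate_succ_apply' (pderiv j), ← Function.iterate_succ_apply' (pderiv j)]
    push_cast
    ring

theorem coeff_iterate_pderiv (j : ι) (s : ℕ) :
    ∀ (F : MvPolynomial ι R) (e : ι →₀ ℕ), coeff e ((pderiv j)^[s] F) =
      ((e j + 1).ascFactorial s : R) * coeff (e + Finsupp.single j s) F := by
  induction s with
  | zero => simp
  | succ s ih =>
    intro F e
    rw [Function.iterate_succ_apply, ih, coeff_pderiv, add_assoc, ← Finsupp.single_add,
      Nat.ascFactorial_succ]
    simp
    ring

variable [DecidableEq ι]

theorem X_sub_X_dvd_sub_rename (i j : ι) (F : MvPolynomial ι R) :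
    (X j - X i : MvPolynomial ι R) ∣ F - rename (Function.update id j i) F := by
  induction F using MvPolynomial.induction_on with
  | C a => simp
  | add p q hp hq =>
    rw [map_add, add_sub_add_comm]
    exact dvd_add hp hq
  | mul_X p k hp =>
    have hk : (X j - X i : MvPolynomial ι R) ∣ X k - rename (Function.update id j i) (X k) := by
      by_cases h : k = j
      · subst h; simp
      · simp [Function.update_of_ne h]
    rw [map_mul]
    have := dvd_add (hp.mul_right (X k))
      (hk.mul_left (rename (Function.update id j i) p))
    convert this using 1
    ring

theorem X_sub_X_dvd_iff {i j : ι} {F : MvPolynomial ι R} :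
    (X j - X i : MvPolynomial ι R) ∣ F ↔ rename (Function.update id j i) F = 0 := by
  constructor
  · rintro ⟨G, rfl⟩
    by_cases h : i = j
    · subst h; simp
    · simp [Function.update_of_ne h]
  · intro h
    simpa [h] using X_sub_X_dvd_sub_rename i j F

theorem prime_X_sub_X [IsDomain R] {i j : ι} (hij : i ≠ j) :
    Prime (X j - X i : MvPolynomial ι R) := by
  have h0 : (X j - X i : MvPolynomial ι R) ≠ 0 := by
    rw [sub_ne_zero]
    exact fun h => hij (X_injective h).symm
  refine ⟨h0, fun hu => ?_, fun a b hab => ?_⟩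
  · have h := (X_sub_X_dvd_iff (F := (1 : MvPolynomial ι R))).1 (isUnit_iff_dvd_one.1 hu)
    simp at h
  · rw [X_sub_X_dvd_iff, map_mul, mul_eq_zero] at hab
    simpa only [X_sub_X_dvd_iff] using hab

/-- If F = (t_j - t_i) G, then on the diagonal the (s+1)-st derivative of F is s+1 times the s-th
derivative of G. Characteristic zero allows division by s+1, and induction applies to G. -/
theorem X_sub_X_pow_dvd [IsDomain R] [CharZero R] {i j : ι} (hij : i ≠ j) (r : ℕ) :
    ∀ F : MvPolynomial ι R,
      (∀ s < r, rename (Function.update id j i) ((pderiv j)^[s] F) = 0) →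
      (X j - X i : MvPolynomial ι R) ^ r ∣ F := by
  induction r with
  | zero => simp
  | succ r ih =>
    intro F hF
    obtain ⟨G, rfl⟩ := X_sub_X_dvd_iff.2 (hF 0 (Nat.succ_pos r))
    rw [pow_succ']
    refine mul_dvd_mul_left _ (ih G fun s hs => ?_)
    have h := hF (s + 1) (Nat.succ_lt_succ hs)
    rw [iterate_pderiv_X_sub_X_mul hij, map_add, map_mul, map_mul,
      X_sub_X_dvd_iff.1 dvd_rfl, zero_mul, zero_add, mul_eq_zero] at h
    refine h.resolve_left ?_
    have : (rename (Function.update id j i) ((s : MvPolynomial ι R) + 1)) =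
      ((s + 1 : ℕ) : MvPolynomial ι R) := by simp
    rw [this]
    exact Nat.cast_ne_zero.2 (Nat.succ_ne_zero s)

/-- Setting t_j = t_i pools the two exponents, so every splitting of `N` contributes. -/
theorem coeff_rename_update {i j : ι} (hij : i ≠ j) (F : MvPolynomial ι R) (d : ι →₀ ℕ)
    (hi : d i = 0) (hj : d j = 0) (N : ℕ) :
    coeff (d + Finsupp.single i N) (rename (Function.update id j i) F) =
      ∑ p ∈ Finset.HasAntidiagonal.antidiagonal N,
        coeff (d + Finsupp.single i p.1 + Finsupp.single j p.2) F := by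
  induction F using MvPolynomial.induction_on' with
  | add p q hp hq => simp only [map_add, coeff_add, hp, hq, Finset.sum_add_distrib]
  | monomial u a =>
    have hu : ∀ p : ℕ × ℕ, u = d + Finsupp.single i p.1 + Finsupp.single j p.2 →
        p = (u i, u j) := by
      rintro p rfl
      ext <;> simp [hi, hj, hij, hij.symm]
    have hmap : Finsupp.mapDomain (Function.update id j i) u = d + Finsupp.single i N ↔
        (u = d + Finsupp.single i (u i) + Finsupp.single j (u j) ∧ u i + u j = N) := by
      have hdec : u = (u.erase i).erase j + Finsupp.single i (u i) + Finsupp.single j (u j) := by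
        ext k
        by_cases h1 : k = i
        · subst h1; simp [hij]
        · by_cases h2 : k = j
          · subst h2; simp [hij]
          · simp [h1, h2]
      have hm : Finsupp.mapDomain (Function.update id j i) u =
          (u.erase i).erase j + Finsupp.single i (u i + u j) := by
        conv_lhs => rw [hdec]
        rw [Finsupp.mapDomain_add, Finsupp.mapDomain_add, Finsupp.mapDomain_single,
          Finsupp.mapDomain_single, Function.update_self, Function.update_of_ne hij, id,
          add_assoc, ← Finsupp.single_add]
        congr 1
        conv_rhs => rw [← Finsupp.mapDomain_id (v := (u.erase i).erase j)]
        refine Finsupp.mapDomain_congr fun k hk => ?_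
        rw [Function.update_of_ne]
        rintro rfl
        simp at hk
      rw [hm]
      constructor
      · intro h
        have hN : u i + u j = N := by
          have := DFunLike.congr_fun h i
          simpa [hi, hij] using this
        refine ⟨?_, hN⟩
        rw [hN] at h
        rw [← add_right_cancel h]
        exact hdec
      · rintro ⟨h, rfl⟩
        congr 1
        rw [add_assoc] at h hdec
        exact add_right_cancel (hdec.symm.trans h)
    rw [rename_monomial, coeff_monomial]
    simp only [coeff_monomial]
    split_ifs with h
    · rw [hmap] at h
      rw [Finset.sum_eq_single (u i, u j), if_pos h.1]
      · intro p _ hp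
        exact if_neg fun h' => hp (hu p h')
      · intro h'
        exact absurd (Finset.HasAntidiagonal.mem_antidiagonal.2 h.2) h'
    · symm
      refine Finset.sum_eq_zero fun p hp => if_neg fun h' => h (hmap.2 ?_)
      have := hu p h'
      subst this
      exact ⟨h', Finset.HasAntidiagonal.mem_antidiagonal.1 hp⟩

theorem coeff_rename_update_of_ne {i j : ι} (hij : i ≠ j) (F : MvPolynomial ι R) (d : ι →₀ ℕ)
    (hj : d j ≠ 0) : coeff d (rename (Function.update id j i) F) = 0 := by
  refine coeff_rename_eq_zero _ _ _ fun u hu => ?_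
  subst hu
  refine absurd (Finsupp.mapDomain_of_notMem_range _ _ ?_) hj
  rintro ⟨k, hk⟩
  by_cases h : k = j
  · subst h; exact hij (by simpa using hk)
  · exact h (by simpa [Function.update_of_ne h] using hk)

end Divisibility

/-! ### Correlation polynomials of a functional -/

section Correlation

open MvPolynomial

variable {ι A : Type*} [Fintype ι] [DecidableEq ι] [CommRing A] [Algebra ℂ A]

/-- The polynomial in the variables `t_i` formed by the terms of degree `M` of
`φ (∏ i, v_i(t_i))`. -/
noncomputable def corr (φ : A →ₗ[ℂ] ℂ) (v : ι → PowerSeries A) (M : ℕ) : MvPolynomial ι ℂ :=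
  ∑ e ∈ Finset.finsuppAntidiag Finset.univ M,
    monomial e (φ (∏ x, PowerSeries.coeff (e x) (v x)))

theorem coeff_corr (φ : A →ₗ[ℂ] ℂ) (v : ι → PowerSeries A) (M : ℕ) (e : ι →₀ ℕ) :
    coeff e (corr φ v M) =
      if ∑ x, e x = M then φ (∏ x, PowerSeries.coeff (e x) (v x)) else 0 := by
  simp only [corr, coeff_sum, coeff_monomial, Finset.sum_ite_eq', Finset.mem_finsuppAntidiag]
  simp

/-- Pooling exponents on the diagonal produces a Cauchy product: the s-th derivative in t_j,
restricted to t_j = t_i, is the correlation of the single series v_i · v_j^{(s)} with the remaining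
factors. -/
theorem X_sub_X_pow_dvd_corr (φ : A →ₗ[ℂ] ℂ) (v : ι → PowerSeries A) (M : ℕ) {i j : ι}
    (hij : i ≠ j) (r : ℕ)
    (h : ∀ s < r, ∀ (N : ℕ) (e : ι → ℕ), (N + s) + ∑ x ∈ {i, j}ᶜ, e x = M →
      φ (PowerSeries.coeff N (v i * (PowerSeries.derivative A)^[s] (v j)) *
        ∏ x ∈ {i, j}ᶜ, PowerSeries.coeff (e x) (v x)) = 0) :
    (X j - X i : MvPolynomial ι ℂ) ^ r ∣ corr φ v M := by
  refine X_sub_X_pow_dvd hij r _ fun s hs => ?_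
  ext e
  rw [coeff_zero]
  by_cases hj : e j = 0
  swap
  · exact coeff_rename_update_of_ne hij _ _ hj
  obtain ⟨d, hi', hj', N, rfl⟩ : ∃ d : ι →₀ ℕ, d i = 0 ∧ d j = 0 ∧ ∃ N,
      e = d + Finsupp.single i N :=
    ⟨e.erase i, by simp, by simp [hij.symm, hj], e i, (Finsupp.erase_add_single i e).symm⟩
  rw [coeff_rename_update hij _ _ hi' hj']
  have hc : ∀ k ∈ ({i, j}ᶜ : Finset ι), k ≠ i ∧ k ≠ j := by
    intro k hk
    simpa using hk
  have hterm : ∀ p ∈ Finset.HasAntidiagonal.antidiagonal N,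
      coeff (d + Finsupp.single i p.1 + Finsupp.single j p.2) ((pderiv j)^[s] (corr φ v M)) =
      if (N + s) + ∑ x ∈ {i, j}ᶜ, d x = M then
        φ ((PowerSeries.coeff p.1 (v i) *
          PowerSeries.coeff p.2 ((PowerSeries.derivative A)^[s] (v j))) *
          ∏ x ∈ {i, j}ᶜ, PowerSeries.coeff (d x) (v x)) else 0 := by
    intro p hp
    rw [Finset.HasAntidiagonal.mem_antidiagonal] at hp
    rw [coeff_iterate_pderiv, coeff_corr, add_assoc _ (Finsupp.single j _),
      ← Finsupp.single_add]
    have hs : ∑ x, (d + Finsupp.single i p.1 + Finsupp.single j (p.2 + s)) x =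
        (N + s) + ∑ x ∈ {i, j}ᶜ, d x := by
      rw [← Finset.sum_add_sum_compl {i, j}, Finset.sum_pair hij]
      congr 1
      · simp [hij, hij.symm, hi', hj']
        omega
      · exact Finset.sum_congr rfl fun k hk => by simp [hc k hk]
    have hpr : ∏ x, PowerSeries.coeff
        ((d + Finsupp.single i p.1 + Finsupp.single j (p.2 + s)) x) (v x) =
        (PowerSeries.coeff p.1 (v i) * PowerSeries.coeff (p.2 + s) (v j)) *
          ∏ x ∈ {i, j}ᶜ, PowerSeries.coeff (d x) (v x) := by
      rw [← Finset.prod_mul_prod_compl {i, j}, Finset.prod_pair hij]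
      congr 1
      · simp [hij, hij.symm, hi', hj']
      · exact Finset.prod_congr rfl fun k hk => by
          simp [(hc k hk).1.symm, (hc k hk).2.symm]
    rw [hs, hpr, PowerSeries.coeff_iterate_derivative]
    split_ifs
    · rw [mul_left_comm, ← nsmul_eq_mul, ← nsmul_eq_mul, smul_mul_assoc, map_nsmul]
      simp [hj', hij]
    · rw [mul_zero]
  rw [Finset.sum_congr rfl hterm]
  split_ifs with hM
  · rw [← map_sum, ← Finset.sum_mul, ← PowerSeries.coeff_mul]
    exact h s hs N d hM
  · simp

end Correlation

/-! ### Products of differences and lexicographic leading exponents -/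

section LeadingExponents

open MvPolynomial

variable {ι : Type*} [Fintype ι] [LinearOrder ι]

/-- The product of the `(t_j - t_i) ^ μ i j` over `i < j`. -/
noncomputable def diffProd (μ : ι → ι → ℕ) : MvPolynomial ι ℂ :=
  ∏ p : ι × ι with p.1 < p.2, (X p.2 - X p.1) ^ μ p.1 p.2

theorem diffProd_ne_zero (μ : ι → ι → ℕ) : diffProd μ ≠ 0 := by
  refine Finset.prod_ne_zero_iff.2 fun p hp => pow_ne_zero _ ?_
  exact (prime_X_sub_X (Finset.mem_filter.1 hp).2.ne).ne_zero

theorem isHomogeneous_diffProd (μ : ι → ι → ℕ) :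
    (diffProd μ).IsHomogeneous (∑ p : ι × ι with p.1 < p.2, μ p.1 p.2) := by
  refine IsHomogeneous.prod _ _ _ fun p _ => ?_
  simpa using ((isHomogeneous_X ℂ p.2).sub (isHomogeneous_X ℂ p.1)).pow (μ p.1 p.2)

/-- The differences over pairs i < j are pairwise non-associated primes. -/
theorem diffProd_dvd (μ : ι → ι → ℕ) {F : MvPolynomial ι ℂ}
    (h : ∀ i j, i < j → (X j - X i : MvPolynomial ι ℂ) ^ μ i j ∣ F) : diffProd μ ∣ F := by
  refine Finset.prod_dvd_of_isRelPrime ?_ fun p hp => h _ _ (Finset.mem_filter.1 hp).2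
  rintro ⟨i, j⟩ hp ⟨i', j'⟩ hp' hne
  have hij : i < j := by simpa using hp
  have hij' : i' < j' := by simpa using hp'
  refine IsRelPrime.pow ?_
  rw [(prime_X_sub_X hij.ne).irreducible.isRelPrime_iff_not_dvd, X_sub_X_dvd_iff]
  simp only [map_sub, rename_X, sub_eq_zero]
  intro h
  have h := X_injective h
  apply hne
  by_cases h1 : j' = j <;> by_cases h2 : i' = j
  · exact absurd (h1.trans h2.symm) hij'.ne'
  · subst h1
    rw [Function.update_self, Function.update_of_ne h2] at h
    simpa using h
  · subst h2
    rw [Function.update_self, Function.update_of_ne h1, id] at h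
    subst h
    exact absurd hij hij'.not_gt
  · rw [Function.update_of_ne h1, Function.update_of_ne h2] at h
    exact absurd h hij'.ne'

theorem prod_ne_eq_prod_lt {M : Type*} [CommMonoid M] (f : ι × ι → M) :
    ∏ p : ι × ι with p.1 ≠ p.2, f p =
      (∏ p : ι × ι with p.1 < p.2, f p) * ∏ p : ι × ι with p.1 < p.2, f p.swap := by
  have h : (Finset.univ.filter fun p : ι × ι => p.1 ≠ p.2) =
      (Finset.univ.filter fun p : ι × ι => p.1 < p.2) ∪
        (Finset.univ.filter fun p : ι × ι => p.2 < p.1) := by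
    ext p
    simp only [Finset.mem_filter, Finset.mem_union, Finset.mem_univ, true_and]
    exact ne_iff_lt_or_gt
  rw [h, Finset.prod_union]
  · congr 1
    exact Finset.prod_equiv (Equiv.prodComm ι ι) (by simp) (by simp)
  · rw [Finset.disjoint_filter]
    exact fun p _ h1 h2 => absurd h1 h2.not_gt

theorem two_mul_sum_lt {μ : ι → ι → ℕ} (hμ : ∀ i j, μ i j = μ j i) :
    2 * ∑ p : ι × ι with p.1 < p.2, μ p.1 p.2 = ∑ p : ι × ι with p.1 ≠ p.2, μ p.1 p.2 := by
  have h := prod_ne_eq_prod_lt (fun p : ι × ι => Multiplicative.ofAdd (μ p.1 p.2))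
  rw [← ofAdd_sum, ← ofAdd_sum, ← ofAdd_sum, ← ofAdd_add] at h
  rw [Multiplicative.ofAdd.injective h, two_mul]
  simp only [Prod.fst_swap, Prod.snd_swap, fun p : ι × ι => hμ p.2 p.1]

/-- Up to a sign, the square is the product over all ordered pairs, which the permutation preserves.
-/
theorem rename_diffProd {μ : ι → ι → ℕ} (hμ : ∀ i j, μ i j = μ j i) (σ : Equiv.Perm ι)
    (hσ : ∀ i j, μ (σ i) (σ j) = μ i j) :
    rename σ (diffProd μ) = diffProd μ ∨ rename σ (diffProd μ) = -diffProd μ := by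
  set Q : MvPolynomial ι ℂ := ∏ p : ι × ι with p.1 ≠ p.2, (X p.2 - X p.1) ^ μ p.1 p.2 with hQ
  set c : MvPolynomial ι ℂ := ∏ p : ι × ι with p.1 < p.2, (-1) ^ μ p.1 p.2 with hc
  have hQP : Q = c * diffProd μ ^ 2 := by
    rw [hQ, prod_ne_eq_prod_lt fun p : ι × ι => (X p.2 - X p.1 : MvPolynomial ι ℂ) ^ μ p.1 p.2,
      pow_two, mul_left_comm]
    refine congrArg (diffProd μ * ·) ?_
    rw [diffProd, hc, ← Finset.prod_mul_distrib]
    refine Finset.prod_congr rfl fun p _ => ?_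
    rw [← mul_pow, Prod.fst_swap, Prod.snd_swap, hμ p.2 p.1]
    ring
  have hσQ : rename σ Q = Q := by
    rw [hQ, map_prod]
    refine Finset.prod_equiv (σ.prodCongr σ) (by simp) fun p _ => ?_
    simp [hσ]
  have hσc : rename σ c = c := by simp [hc]
  have hc0 : c ≠ 0 := Finset.prod_ne_zero_iff.2 fun p _ => pow_ne_zero _ (by simp)
  rw [hQP, map_mul, map_pow, hσc] at hσQ
  exact sq_eq_sq_iff_eq_or_eq_neg.1 (mul_left_cancel₀ hc0 hσQ)

/-- The cofactor of `diffProd` is symmetric or antisymmetric under each swap within a kind, so its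
support is swap-invariant. If its leading exponent were larger at the later index, swapping would
give a lex-larger exponent in the support. -/
theorem exists_lexDegree_eq {K : Type*} (k : ι → K) {μ : ι → ι → ℕ}
    (hμ : ∀ i j, μ i j = μ j i) (hk : ∀ i i' j j', k i = k i' → k j = k j' → μ i j = μ i' j')
    {F : MvPolynomial ι ℂ} (hF : F ≠ 0) (hdvd : diffProd μ ∣ F)
    (hsymm : ∀ i j, k i = k j → rename (Equiv.swap i j) F = F) :
    ∃ e : ι →₀ ℕ, MonomialOrder.lex.degree F = MonomialOrder.lex.degree (diffProd μ) + e ∧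
      ∀ i j, i < j → k i = k j → e j ≤ e i := by
  obtain ⟨h, rfl⟩ := hdvd
  have hh : h ≠ 0 := right_ne_zero_of_mul hF
  refine ⟨MonomialOrder.lex.degree h, MonomialOrder.degree_mul (diffProd_ne_zero μ) hh, ?_⟩
  intro i j hij hkij
  by_contra! hlt
  set e := MonomialOrder.lex.degree h with he
  have hswap : ∀ x, k (Equiv.swap i j x) = k x := by
    intro x
    rcases eq_or_ne x i with rfl | hxi
    · rw [Equiv.swap_apply_left, hkij]
    rcases eq_or_ne x j with rfl | hxj
    · rw [Equiv.swap_apply_right, hkij]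
    rw [Equiv.swap_apply_of_ne_of_ne hxi hxj]
  have hren : rename (Equiv.swap i j) h = h ∨ rename (Equiv.swap i j) h = -h := by
    have h1 := hsymm i j hkij
    rw [map_mul] at h1
    rcases rename_diffProd hμ (Equiv.swap i j)
      (fun x y => hk _ _ _ _ (hswap x) (hswap y)) with h2 | h2 <;> rw [h2] at h1
    · exact Or.inl (mul_left_cancel₀ (diffProd_ne_zero μ) h1)
    · rw [neg_mul, ← mul_neg] at h1
      exact Or.inr (neg_eq_iff_eq_neg.1 (mul_left_cancel₀ (diffProd_ne_zero μ) h1))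
  have hcoeff : coeff (e.mapDomain (Equiv.swap i j)) (rename (Equiv.swap i j) h) = coeff e h :=
    coeff_rename_mapDomain _ (Equiv.swap i j).injective _ _
  have hne : coeff (e.mapDomain (Equiv.swap i j)) h ≠ 0 := by
    have h0 : coeff e h ≠ 0 := MonomialOrder.coeff_degree_ne_zero_iff.2 hh
    rw [← hcoeff] at h0
    rcases hren with h3 | h3 <;> rw [h3] at h0
    · exact h0
    · simpa using h0
  have hle := MonomialOrder.lex.le_degree (mem_support_iff.2 hne)
  rw [← he, MonomialOrder.lex_le_iff] at hle
  refine absurd hle (not_le.2 ?_)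
  rw [Finsupp.Lex.lt_iff]
  have hval : ∀ x, e.mapDomain (Equiv.swap i j) x = e (Equiv.swap i j x) := by
    intro x
    conv_lhs => rw [← Equiv.swap_apply_self i j x]
    exact Finsupp.mapDomain_apply (Equiv.swap i j).injective _ _
  refine ⟨i, fun x hx => ?_, ?_⟩
  · change e x = e.mapDomain (Equiv.swap i j) x
    rw [hval, Equiv.swap_apply_of_ne_of_ne hx.ne (hx.trans hij).ne]
  · change e i < e.mapDomain (Equiv.swap i j) i
    rwa [hval, Equiv.swap_apply_left]

end LeadingExponents

/-! ### Counting partitions -/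

section Counting

theorem inv_one_sub_X_pow {d : ℕ} (hd : 0 < d) :
    (1 - PowerSeries.X ^ d : PowerSeries ℚ)⁻¹ = PowerSeries.mk fun n => if d ∣ n then 1 else 0 := by
  symm
  rw [PowerSeries.eq_inv_iff_mul_eq_one (by simp [hd.ne'])]
  ext n
  rw [mul_sub, mul_one, map_sub, PowerSeries.coeff_mul_X_pow', PowerSeries.coeff_mk,
    PowerSeries.coeff_one]
  by_cases h : d ≤ n
  · have hn : n ≠ 0 := by omega
    simp [h, hn, Nat.dvd_sub_iff_left h dvd_rfl]
  · rw [if_neg h, sub_zero]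
    refine if_congr ⟨fun h' => Nat.eq_zero_of_dvd_of_lt h' (not_le.1 h), ?_⟩ rfl rfl
    rintro rfl
    exact dvd_zero d

theorem coeff_prod_inv_one_sub_X_pow {κ : Type*} [Fintype κ] [DecidableEq κ] (d : κ → ℕ)
    (hd : ∀ x, 0 < d x) (M : ℕ) :
    PowerSeries.coeff M (∏ x, (1 - PowerSeries.X ^ d x : PowerSeries ℚ)⁻¹) =
      ((Finset.univ.finsuppAntidiag M).filter fun l : κ →₀ ℕ => ∀ x, d x ∣ l x).card := by
  simp_rw [inv_one_sub_X_pow (hd _)]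
  rw [PowerSeries.coeff_prod, Finset.card_filter, Nat.cast_sum]
  refine Finset.sum_congr rfl fun l _ => ?_
  simp only [PowerSeries.coeff_mk]
  split_ifs with h
  · simp [h]
  · push Not at h
    obtain ⟨x, hx⟩ := h
    rw [Nat.cast_zero]
    exact Finset.prod_eq_zero (Finset.mem_univ x) (if_neg hx)

theorem inv_qPoch (n : ℕ) :
    (qPoch n)⁻¹ = ∏ i : Fin n, (1 - PowerSeries.X ^ ((i : ℕ) + 1) : PowerSeries ℚ)⁻¹ := by
  rw [Fin.prod_univ_eq_prod_range (fun i => (1 - PowerSeries.X ^ (i + 1) : PowerSeries ℚ)⁻¹)]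
  unfold qPoch
  induction n with
  | zero => simp
  | succ n ih => rw [Finset.prod_range_succ, Finset.prod_range_succ, PowerSeries.mul_inv_rev, ih,
      mul_comm]

/-- The partitions of `M` into five parts, the `k`-th of which has parts of size at most `n k`;
`l ⟨k, j⟩` is the sum of the parts of size `j + 1`. -/
noncomputable def partCounts (n : Fin 5 → ℕ) (M : ℕ) : Finset ((Σ k, Fin (n k)) →₀ ℕ) :=
  (Finset.univ.finsuppAntidiag M).filter fun l => ∀ x, (x.2 : ℕ) + 1 ∣ l x

theorem coeff_fermTerm (n : Fin 5 → ℕ) (m : ℕ) :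
    PowerSeries.coeff m (fermTerm n) =
      if fermExp n ≤ m then ((partCounts n (m - fermExp n)).card : ℚ) else 0 := by
  rw [fermTerm, PowerSeries.coeff_X_pow_mul']
  simp_rw [inv_qPoch]
  rw [← Fintype.prod_sigma' fun (k : Fin 5) (i : Fin (n k)) =>
    (1 - PowerSeries.X ^ ((i : ℕ) + 1) : PowerSeries ℚ)⁻¹]
  rw [coeff_prod_inv_one_sub_X_pow (fun x : Σ k, Fin (n k) => (x.2 : ℕ) + 1)
    fun x => Nat.succ_pos _]
  rfl

theorem sum_Ico_sub_succ {E : ℕ → ℕ} (hE : Antitone E) {i m : ℕ} (h : i ≤ m) :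
    ∑ j ∈ Finset.Ico i m, (E j - E (j + 1)) = E i - E m := by
  induction m, h using Nat.le_induction with
  | base => simp
  | succ m h ih =>
    rw [Finset.sum_Ico_succ_top h, ih]
    have := hE h
    have := hE (Nat.le_succ m)
    simp only [Nat.succ_eq_add_one] at this
    omega

/-- The gaps between consecutive entries are the multiplicities of the parts of the conjugate
partition. -/
theorem exists_gaps {n : ℕ} (e : Fin n → ℕ) (he : Antitone e) :
    ∃ g : Fin n → ℕ, (∀ i, ∑ j with i ≤ j, g j = e i) ∧ ∑ j : Fin n, ((j : ℕ) + 1) * g j = ∑ i, e i := by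
  -- Extension by 0 makes the last gap equal to the last entry.
  set E : ℕ → ℕ := fun j => if h : j < n then e ⟨j, h⟩ else 0 with hEdef
  have hE : Antitone E := by
    intro a b hab
    simp only [hEdef]
    split_ifs with h1 h2
    · exact he hab
    · omega
    · exact Nat.zero_le _
    · exact le_rfl
  have hg : ∀ i : Fin n, ∑ j : Fin n with i ≤ j, (E j - E (j + 1)) = e i := by
    intro i
    have h : ∑ j : Fin n with i ≤ j, (E j - E (j + 1)) =
        ∑ j ∈ Finset.Ico (i : ℕ) n, (E j - E (j + 1)) := by
      rw [Finset.sum_filter]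
      simp only [Fin.le_def]
      rw [Fin.sum_univ_eq_sum_range (fun j => if (i : ℕ) ≤ j then E j - E (j + 1) else 0),
        ← Finset.sum_filter]
      refine Finset.sum_congr ?_ fun _ _ => rfl
      ext j
      simp [and_comm]
    rw [h, sum_Ico_sub_succ hE i.2.le]
    simp [hEdef]
  refine ⟨fun j => E j - E (j + 1), hg, ?_⟩
  simp_rw [← hg, Finset.sum_filter]
  rw [Finset.sum_comm]
  refine Finset.sum_congr rfl fun j _ => ?_
  rw [← Finset.sum_filter, Finset.sum_const, smul_eq_mul]
  congr 1
  have : (Finset.univ.filter fun i : Fin n => i ≤ j) = Finset.Iic j := by ext; simp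
  rw [this, Fin.card_Iic]

/-- The exponents of which `l` records the partitions. -/
def expOfParts {n : Fin 5 → ℕ} (l : (Σ k, Fin (n k)) →₀ ℕ) (x : Σ k, Fin (n k)) : ℕ :=
  ∑ j : Fin (n x.1) with x.2 ≤ j, l ⟨x.1, j⟩ / ((j : ℕ) + 1)

/-- Surjectivity suffices, since only an upper bound on the number of products is needed. -/
theorem exists_expOfParts_eq {n : Fin 5 → ℕ} (e : (Σ k, Fin (n k)) → ℕ)
    (he : ∀ k, Antitone fun i : Fin (n k) => e ⟨k, i⟩) :
    ∃ l ∈ partCounts n (∑ x, e x), expOfParts l = e := by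
  choose g hg hsum using fun k => exists_gaps _ (he k)
  refine ⟨Finsupp.equivFunOnFinite.symm fun x => ((x.2 : ℕ) + 1) * g x.1 x.2, ?_, ?_⟩
  · simp only [partCounts, Finset.mem_filter, Finset.mem_finsuppAntidiag]
    refine ⟨⟨?_, by simp⟩, fun x => by simp⟩
    rw [Fintype.sum_sigma, Fintype.sum_sigma]
    exact Finset.sum_congr rfl fun k _ => hsum k
  · funext x
    rw [← hg x.1 x.2]
    refine Finset.sum_congr rfl fun j _ => ?_
    simp

end Counting

/-! ### The five kinds of factors and their vanishing orders -/

section Kinds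

/-- For `g = (x_{ε₁+ε₂}(t), x_{ε₁-ε₂}(t), x_{ε₂}(t), x_{ε₁}(t))`, the series `x_{ε₁+ε₂}(t)`,
`x_{ε₁-ε₂}(t)`, `x_{ε₂}(t)²`, `x_{ε₁}(t)`, `x_{ε₂}(t)`, in the order of the summation variables. -/
def kindSeries {R : Type*} [Monoid R] (g : Fin 4 → R) : Fin 5 → R :=
  ![g 0, g 1, g 2 ^ 2, g 3, g 2]

/-- The number of factors of each `kindSeries k`. -/
def kindWeight : Fin 5 → ℕ := ![1, 1, 2, 1, 1]

/-- The order to which `kindSeries k (t) * kindSeries k' (u)` vanishes at `t = u`. -/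
def kindMult : Fin 5 → Fin 5 → ℕ :=
  ![![2, 0, 2, 1, 1], ![0, 2, 0, 1, 0], ![2, 0, 4, 1, 2], ![1, 1, 1, 2, 0], ![1, 0, 2, 0, 2]]

theorem kindMult_comm : ∀ k k', kindMult k k' = kindMult k' k := by decide

variable {A : Type*} [CommRing A] [Algebra ℂ A]

theorem mul_derivative_eq_zero {f : PowerSeries A} (h : f ^ 2 = 0) :
    f * PowerSeries.derivative A f = 0 := by
  have h2 := congrArg (PowerSeries.derivative A) h
  rw [map_zero, pow_two, Derivation.leibniz, smul_eq_mul, ← two_mul] at h2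
  have h3 : (2 : ℂ) • (f * PowerSeries.derivative A f) = 0 := by
    rw [two_smul, ← two_mul, h2]
  exact (smul_eq_zero_iff_right two_ne_zero).1 h3

theorem sq_mul_derivative_eq_zero {f : PowerSeries A} (h : f ^ 3 = 0) :
    f ^ 2 * PowerSeries.derivative A f = 0 := by
  have h2 := congrArg (PowerSeries.derivative A) h
  rw [map_zero, Derivation.leibniz_pow, smul_eq_mul] at h2
  have h3 : (3 : ℂ) • (f ^ 2 * PowerSeries.derivative A f) = 0 := by
    rw [← h2, show (3 : ℂ) = ((3 : ℕ) : ℂ) by norm_num, Nat.cast_smul_eq_nsmul]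
  exact (smul_eq_zero_iff_right three_ne_zero).1 h3

/-- Everything follows by the Leibniz rule from the relations and the derivatives of the pure
powers, f f' = 0 or f² f' = 0. The pair (4, 4) is excluded because the relations do not force
x_{ε₂}(t)² = 0. -/
theorem kindSeries_mul_iterate_derivative {g : Fin 4 → PowerSeries A}
    (hg : ∀ f ∈ relB, MvPolynomial.aeval g f = 0) {k k' : Fin 5} (hk : k ≤ k') (h4 : k ≠ 4)
    {s : ℕ} (hs : s < kindMult k k') :
    kindSeries g k * (PowerSeries.derivative A)^[s] (kindSeries g k') = 0 := by
  simp only [relB, Set.mem_insert_iff, Set.mem_singleton_iff, forall_eq_or_imp, forall_eq,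
    map_mul, map_pow, MvPolynomial.aeval_X] at hg
  obtain ⟨haa, hbb, hdd, hca, hdb, hda, hccc, hccd⟩ := hg
  have haa' := mul_derivative_eq_zero haa
  have hbb' := mul_derivative_eq_zero hbb
  have hdd' := mul_derivative_eq_zero hdd
  have hccc' := sq_mul_derivative_eq_zero hccc
  have hs4 : s < 4 := hs.trans_le ((by decide : ∀ k k', kindMult k k' ≤ 4) k k')
  rw [kindSeries]
  generalize ha' : PowerSeries.derivative A (g 0) = a' at haa'
  generalize hb' : PowerSeries.derivative A (g 1) = b' at hbb'
  generalize hd' : PowerSeries.derivative A (g 3) = d' at hdd'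
  generalize hc' : PowerSeries.derivative A (g 2) = c' at hccc'
  generalize hc'' : PowerSeries.derivative A c' = c''
  generalize hc''' : PowerSeries.derivative A c'' = c'''
  generalize g 0 = a at *
  generalize g 1 = b at *
  generalize g 2 = c at *
  generalize g 3 = d at *
  interval_cases s <;> fin_cases k <;> fin_cases k' <;>
    first
    | exact absurd hs (by decide)
    | exact absurd hk (by decide)
    | exact absurd rfl h4
    | (clear hs hk h4
       simp [pow_two, Derivation.leibniz, ha', hb', hc', hc'', hc''', hd', map_add]
       grind)

end Kinds

/-! ### Positions of factors and the degree count -/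

section Positions

/-- Positions of a monomial with `n k` factors of kind `k`, ordered by kind first. -/
def Position (n : Fin 5 → ℕ) : Type := Σₗ k : Fin 5, Fin (n k)

noncomputable instance (n : Fin 5 → ℕ) : LinearOrder (Position n) :=
  inferInstanceAs (LinearOrder (Σₗ k : Fin 5, Fin (n k)))

instance (n : Fin 5 → ℕ) : Fintype (Position n) :=
  inferInstanceAs (Fintype (Σ k : Fin 5, Fin (n k)))

/-- The kind of a position. -/
def Position.kind {n : Fin 5 → ℕ} (x : Position n) : Fin 5 := x.1

variable {n : Fin 5 → ℕ}

theorem Position.kind_le {x y : Position n} (h : x < y) : x.kind ≤ y.kind := by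
  rcases Sigma.Lex.lt_def.1 h with h | ⟨h, _⟩
  · exact h.le
  · exact h.le

theorem Position.mk_lt {k : Fin 5} {i j : Fin (n k)} (h : i < j) :
    (show Position n from ⟨k, i⟩) < (show Position n from ⟨k, j⟩) :=
  Sigma.Lex.lt_def.2 (Or.inr ⟨rfl, h⟩)

theorem sum_position {M : Type*} [AddCommMonoid M] (f : Fin 5 → M) :
    ∑ x : Position n, f x.kind = ∑ k, n k • f k := by
  refine (Fintype.sum_sigma (fun x : Σ k : Fin 5, Fin (n k) => f x.1)).trans ?_
  simp

theorem exists_equiv_position {ι : Type*} [Fintype ι] (kind : ι → Fin 5) :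
    ∃ (n : Fin 5 → ℕ) (f : Position n ≃ ι), ∀ x, kind (f x) = x.kind := by
  classical
  let f : (Σ k : Fin 5, Fin (Fintype.card {i // kind i = k})) ≃ ι :=
    (Equiv.sigmaCongrRight fun k => (Fintype.equivFin {i // kind i = k}).symm).trans
      (Equiv.sigmaFiberEquiv kind)
  exact ⟨fun k => Fintype.card {i // kind i = k}, f,
    fun x => ((Fintype.equivFin {i // kind i = x.1}).symm x.2).2⟩

/-- The order of vanishing of the correlations at the diagonal of two positions. -/
def posMult (x y : Position n) : ℕ := kindMult x.kind y.kind

/-- The lexicographically leading exponent of the product of the differences. -/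
noncomputable def leadExp (n : Fin 5 → ℕ) : Position n →₀ ℕ :=
  MonomialOrder.lex.degree (diffProd (posMult (n := n)))

/-- The leading exponent itself is never computed: by homogeneity its total is the sum of
multiplicities over pairs. The diagonal entries of `kindMult` are twice `kindWeight`, so the terms
linear in n_k cancel. -/
theorem sum_leadExp_add (n : Fin 5 → ℕ) :
    ∑ x, leadExp n x + ∑ x : Position n, kindWeight x.kind = fermExp n := by
  have h1 : ∑ x, leadExp n x = ∑ p : Position n × Position n with p.1 < p.2, posMult p.1 p.2 := by
    have h := isHomogeneous_diffProd (posMult (n := n))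
      (MonomialOrder.lex.coeff_degree_ne_zero_iff.2 (diffProd_ne_zero posMult))
    rw [← h, Finsupp.weight_apply, Finsupp.sum_fintype _ _ (by simp)]
    simp [leadExp]
  have h2 := two_mul_sum_lt (μ := posMult (n := n)) fun i j => kindMult_comm _ _
  have h3 : ∑ p : Position n × Position n with p.1 ≠ p.2, posMult p.1 p.2 +
      ∑ x : Position n, kindMult x.kind x.kind =
      ∑ x : Position n, ∑ y : Position n, kindMult x.kind y.kind := by
    rw [← Fintype.sum_prod_type' fun x y : Position n => kindMult x.kind y.kind,
      ← Finset.sum_filter_add_sum_filter_not Finset.univ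
        (fun p : Position n × Position n => p.1 ≠ p.2)]
    congr 1
    refine Finset.sum_nbij' (fun x => (x, x)) Prod.fst ?_ ?_ ?_ ?_ ?_ <;> simp
  have h4 : ∀ x : Position n, ∑ y : Position n, kindMult x.kind y.kind =
      ∑ k', n k' • kindMult x.kind k' := fun x => sum_position _
  simp_rw [h4] at h3
  rw [sum_position fun k => ∑ k', n k' • kindMult k k', sum_position fun k => kindMult k k] at h3
  rw [h1, sum_position]
  simp only [Fin.sum_univ_five, kindMult, kindWeight, smul_eq_mul] at h3 ⊢
  simp at h3 ⊢
  unfold fermExp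
  rw [← h2] at h3
  zify at h3 ⊢
  linarith

end Positions

/-! ### Vanishing of correlations by induction -/

section Vanishing

open MvPolynomial

variable {A : Type*} [CommRing A] [Algebra ℂ A]

theorem rename_corr {ι : Type*} [Fintype ι] [DecidableEq ι] (φ : A →ₗ[ℂ] ℂ)
    (v : ι → PowerSeries A) (M : ℕ) (σ : Equiv.Perm ι) (hσ : ∀ x, v (σ x) = v x) :
    rename σ (corr φ v M) = corr φ v M := by
  ext e
  have hval : ∀ x, (e.mapDomain σ.symm) x = e (σ x) := by
    intro x
    conv_lhs => rw [← σ.symm_apply_apply x]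
    exact Finsupp.mapDomain_apply σ.symm.injective _ _
  have he : e = (e.mapDomain σ.symm).mapDomain σ := by
    rw [← Finsupp.mapDomain_comp, Equiv.self_comp_symm, Finsupp.mapDomain_id]
  conv_lhs => rw [he]
  rw [coeff_rename_mapDomain _ σ.injective, coeff_corr, coeff_corr]
  simp_rw [hval]
  rw [Equiv.sum_comp σ (fun x => e x)]
  congr 2
  rw [← Equiv.prod_comp σ fun x => PowerSeries.coeff (e x) (v x)]
  simp_rw [hσ]

/-- The value of `φ` vanishes on all products of coefficients of the series `v i`, one for each
`i`, whose total degree is `M`. -/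
def VanishesOn {ι : Type*} [Fintype ι] (φ : A →ₗ[ℂ] ℂ) (v : ι → PowerSeries A) (M : ℕ) : Prop :=
  ∀ e : ι → ℕ, ∑ x, e x = M → φ (∏ x, PowerSeries.coeff (e x) (v x)) = 0

theorem vanishesOn_of_corr_eq_zero {ι : Type*} [Fintype ι] [DecidableEq ι] {φ : A →ₗ[ℂ] ℂ}
    {v : ι → PowerSeries A} {M : ℕ} (h : corr φ v M = 0) : VanishesOn φ v M := by
  intro e he
  have := coeff_corr φ v M (Finsupp.equivFunOnFinite.symm e)
  rw [h, coeff_zero] at this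
  simpa [he] using this.symm

theorem VanishesOn.of_equiv {ι κ : Type*} [Fintype ι] [Fintype κ] {φ : A →ₗ[ℂ] ℂ}
    {v : ι → PowerSeries A} {u : κ → PowerSeries A} {M : ℕ} (f : κ ≃ ι)
    (hf : ∀ x, v (f x) = u x) (h : VanishesOn φ u M) : VanishesOn φ v M := by
  intro e he
  rw [← Equiv.prod_comp f]
  simp_rw [hf]
  refine h (e ∘ f) ?_
  rw [← he]
  exact Equiv.sum_comp f e

/-- Merging the positions `i` and `j` into one. -/
theorem VanishesOn.merge {ι : Type*} [Fintype ι] [DecidableEq ι] {φ : A →ₗ[ℂ] ℂ}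
    {v : ι → PowerSeries A} {M : ℕ} {i j : ι} (hij : i ≠ j) {w : PowerSeries A}
    (h : VanishesOn φ (fun x : {x // x ≠ j} => Function.update v i w x) M)
    (N : ℕ) (e : ι → ℕ) (he : N + ∑ x ∈ {i, j}ᶜ, e x = M) :
    φ (PowerSeries.coeff N w * ∏ x ∈ {i, j}ᶜ, PowerSeries.coeff (e x) (v x)) = 0 := by
  have hmem : ∀ x, x ∈ insert i ({i, j}ᶜ : Finset ι) ↔ x ≠ j := by
    intro x
    by_cases hx : x = i
    · simp [hx, hij]
    · simp [hx]
  have hi : i ∉ ({i, j}ᶜ : Finset ι) := by simp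
  have hne : ∀ x ∈ ({i, j}ᶜ : Finset ι), x ≠ i := fun x hx => by rintro rfl; exact hi hx
  have h1 := h (fun x => Function.update e i N x) (by
    rw [← Finset.sum_subtype _ hmem (Function.update e i N), Finset.sum_insert hi,
      Function.update_self, ← he]
    congr 1
    exact Finset.sum_congr rfl fun x hx => Function.update_of_ne (hne x hx) _ _)
  rw [← Finset.prod_subtype _ hmem fun x =>
      PowerSeries.coeff (Function.update e i N x) (Function.update v i w x),
    Finset.prod_insert hi, Function.update_self, Function.update_self] at h1
  rw [← h1]
  congr 2
  exact Finset.prod_congr rfl fun x hx => by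
    rw [Function.update_of_ne (hne x hx), Function.update_of_ne (hne x hx)]

variable {g : Fin 4 → PowerSeries A} {φ : A →ₗ[ℂ] ℂ}

/-- The product of coefficients of the `kindSeries` with exponents `leadExp n + e`. -/
noncomputable def spanProd (g : Fin 4 → PowerSeries A) (n : Fin 5 → ℕ) (e : Position n → ℕ) : A :=
  ∏ x : Position n, PowerSeries.coeff (leadExp n x + e x) (kindSeries g x.kind)

theorem corr_eq_zero (hg : ∀ f ∈ relB, aeval g f = 0) {n : Fin 5 → ℕ} {M : ℕ}
    (hφ : ∀ e : Position n → ℕ, (∀ x y, x < y → x.kind = y.kind → e y ≤ e x) →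
      ∑ x, (leadExp n x + e x) = M → φ (spanProd g n e) = 0)
    (hmerge : ∀ i j : Position n, i ≠ j → i.kind = 4 → j.kind = 4 →
      VanishesOn φ (fun x : {x // x ≠ j} =>
        Function.update (fun x : Position n => kindSeries g x.kind) i (kindSeries g 2) x) M) :
    corr φ (fun x : Position n => kindSeries g x.kind) M = 0 := by
  by_contra hF
  have hdvd : diffProd (posMult (n := n)) ∣ corr φ (fun x : Position n => kindSeries g x.kind) M := by
    refine diffProd_dvd _ fun i j hij => X_sub_X_pow_dvd_corr φ _ M hij.ne _ ?_
    intro s hs N e hM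
    by_cases h4 : i.kind = 4
    swap
    · rw [kindSeries_mul_iterate_derivative hg (Position.kind_le hij) h4 hs]
      simp
    -- Kind 4 is the last one, so a later position is again of kind 4.
    have h4' : j.kind = 4 := le_antisymm (Fin.le_last _) (h4 ▸ Position.kind_le hij)
    have key := (hmerge i j hij.ne h4 h4').merge hij.ne
    rw [posMult, h4, h4'] at hs
    simp only [h4, h4']
    have h2 : kindSeries g 2 = kindSeries g 4 * kindSeries g 4 := pow_two (g 2)
    rw [h2] at key
    generalize kindSeries g 4 = c at key ⊢
    have hs2 : s < 2 := hs
    interval_cases s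
    · exact key N e hM
    · have hd : (2 : ℂ) • (c * PowerSeries.derivative A c) = PowerSeries.derivative A (c * c) := by
        rw [Derivation.leibniz, smul_eq_mul, two_smul]
      -- Since 2cc' = (c²)', the coefficient of index `N` comes from that of c² at `N + 1`.
      have h3 := key (N + 1) e hM
      have h5 : (2 : ℂ) * φ (PowerSeries.coeff N (c * PowerSeries.derivative A c) *
          ∏ x ∈ {i, j}ᶜ, PowerSeries.coeff (e x) (kindSeries g x.kind)) = 0 := by
        rw [← smul_eq_mul, ← map_smul, ← smul_mul_assoc, ← PowerSeries.coeff_smul, hd,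
          PowerSeries.coeff_derivative, mul_assoc, mul_left_comm, ← Nat.cast_succ,
          ← nsmul_eq_mul, map_nsmul, h3, smul_zero]
      exact (mul_eq_zero.1 h5).resolve_left two_ne_zero
  obtain ⟨e, he, hanti⟩ := exists_lexDegree_eq Position.kind (μ := posMult (n := n))
    (fun i j => kindMult_comm _ _) (fun i i' j j' h h' => by simp only [posMult, h, h']) hF hdvd
    (fun i j hij => rename_corr _ _ _ _ fun x => by
      congr 1
      rcases eq_or_ne x i with rfl | hxi
      · rw [Equiv.swap_apply_left, hij]
      rcases eq_or_ne x j with rfl | hxj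
      · rw [Equiv.swap_apply_right, hij]
      rw [Equiv.swap_apply_of_ne_of_ne hxi hxj])
  have hc := MonomialOrder.lex.coeff_degree_ne_zero_iff.2 hF
  rw [he, coeff_corr] at hc
  split_ifs at hc with hM
  · exact hc (hφ e hanti hM)
  · exact hc rfl

/-- Merging two single factors x_{ε₂} into a square keeps `M` and the total weight but lowers the
number of single factors by two. The index type varies because merging removes a position. -/
theorem vanishesOn_kindSeries (hg : ∀ f ∈ relB, aeval g f = 0) {m : ℕ}
    (hφ : ∀ (n : Fin 5 → ℕ) (e : Position n → ℕ), (∀ x y, x < y → x.kind = y.kind → e y ≤ e x) →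
      fermExp n + ∑ x, e x = m → φ (spanProd g n e) = 0) (c : ℕ) :
    ∀ (ι : Type) [Fintype ι] (kind : ι → Fin 5) (M : ℕ),
      (Finset.univ.filter fun x => kind x = 4).card = c → M + ∑ x, kindWeight (kind x) = m →
      VanishesOn φ (fun x => kindSeries g (kind x)) M := by
  induction c using Nat.strong_induction_on with
  | _ c ih =>
  intro ι _ kind M hc hM
  obtain ⟨n, f, hf⟩ := exists_equiv_position kind
  have hc' : (Finset.univ.filter fun x : Position n => x.kind = 4).card = c := by
    rw [← hc, Finset.card_filter, Finset.card_filter, ← Equiv.sum_comp f]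
    simp_rw [hf]
  have hM' : M + ∑ x : Position n, kindWeight x.kind = m := by
    rw [← hM, ← Equiv.sum_comp f (fun x => kindWeight (kind x))]
    simp_rw [hf]
  refine VanishesOn.of_equiv f (u := fun x : Position n => kindSeries g x.kind)
    (fun x => by rw [hf]) (vanishesOn_of_corr_eq_zero (corr_eq_zero hg ?_ ?_))
  · intro e he hsum
    refine hφ n e he ?_
    rw [← sum_leadExp_add, ← hM', ← hsum, Finset.sum_add_distrib]
    ring
  · intro i j hij hi hj
    have hmem : ∀ x, x ∈ insert i ({i, j}ᶜ : Finset (Position n)) ↔ x ≠ j := by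
      intro x
      by_cases hx : x = i
      · simp [hx, hij]
      · simp [hx]
    have hni : i ∉ ({i, j}ᶜ : Finset (Position n)) := by simp
    have hne : ∀ x ∈ ({i, j}ᶜ : Finset (Position n)), x ≠ i :=
      fun x hx => by rintro rfl; exact hni hx
    -- Balance of an arbitrary additive statistic under the merge; it is used for the number of
    -- factors of kind 4 and for the weight.
    have hsum : ∀ q : Fin 5 → ℕ,
        ∑ x : {x // x ≠ j}, q (Function.update Position.kind i 2 x.1) + 2 * q 4 =
          q 2 + ∑ x : Position n, q x.kind := by
      intro q
      rw [← Finset.sum_subtype _ hmem (fun x => q (Function.update Position.kind i 2 x)),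
        Finset.sum_insert hni, Function.update_self, ← Finset.sum_add_sum_compl {i, j},
        Finset.sum_pair hij, hi, hj, Finset.sum_congr rfl fun x hx => by
          rw [Function.update_of_ne (hne x hx)]]
      ring
    have h1 := hsum fun k => if k = 4 then 1 else 0
    have h2 := hsum kindWeight
    rw [← Finset.card_filter, ← Finset.card_filter, hc'] at h1
    have hlt : (Finset.univ.filter fun x : {x : Position n // x ≠ j} =>
        Function.update Position.kind i 2 x.1 = 4).card < c := by
      rw [if_pos rfl, if_neg (by decide)] at h1
      have h4 : ∀ a : ℕ, a + 2 * 1 = 0 + c → a < c := fun a ha => by omega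
      refine h4 _ ?_
      convert h1
    have h3 := ih _ hlt {x : Position n // x ≠ j}
      (fun x => Function.update Position.kind i 2 x.1) M rfl (by
        simp [kindWeight] at h2 hM' ⊢; omega)
    convert h3 using 2 with x
    by_cases hx : x.1 = i
    · rw [hx]; simp
    · rw [Function.update_of_ne hx, Function.update_of_ne hx]

end Vanishing

/-! ### The spanning set and its cardinality -/

section HilbertSeries

/-- The exponents of which `l` records the partitions, shifted and multiplied out. -/
noncomputable def partProd (p : Σ n : Fin 5 → ℕ, (Σ k, Fin (n k)) →₀ ℕ) : JetAlgebra relB :=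
  spanProd (genSeries relB) p.1 (expOfParts p.2)

/-- Partitions indexing a spanning set of the component of weight `m`. -/
noncomputable def partIndex (m : ℕ) : Finset (Σ n : Fin 5 → ℕ, (Σ k, Fin (n k)) →₀ ℕ) :=
  (fermTerm_support_finite m).toFinset.sigma fun n => partCounts n (m - fermExp n)

theorem card_partIndex (m : ℕ) :
    ((partIndex m).card : ℚ) = PowerSeries.coeff m fermSum := by
  rw [partIndex, Finset.card_sigma, Nat.cast_sum, fermSum, PowerSeries.coeff_mk,
    finsum_eq_sum_of_support_subset (s := (fermTerm_support_finite m).toFinset) _ (by simp)]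
  refine Finset.sum_congr rfl fun n hn => ?_
  have h0 : PowerSeries.coeff m (fermTerm n) ≠ 0 := by simpa using hn
  rw [coeff_fermTerm] at h0 ⊢
  split_ifs at h0 ⊢
  · rfl
  · exact absurd rfl h0

theorem exists_partProd_eq {m : ℕ} {n : Fin 5 → ℕ} (e : Position n → ℕ)
    (he : ∀ x y, x < y → x.kind = y.kind → e y ≤ e x) (hm : fermExp n + ∑ x, e x = m) :
    ∃ p ∈ partIndex m, partProd p = spanProd (genSeries relB) n e := by
  obtain ⟨l, hl, hle⟩ := exists_expOfParts_eq (n := n) e fun k i j hij => by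
    rcases hij.lt_or_eq with h | h
    · exact he _ _ (Position.mk_lt h) rfl
    · rw [h]
  have hl' : l ∈ partCounts n (m - fermExp n) := by
    rw [← hm, Nat.add_sub_cancel_left]
    exact hl
  refine ⟨⟨n, l⟩, Finset.mem_sigma.2 ⟨?_, hl'⟩, ?_⟩
  · rw [Set.Finite.mem_toFinset, Function.mem_support, coeff_fermTerm,
      if_pos (hm ▸ Nat.le_add_right _ _), Nat.cast_ne_zero]
    exact Finset.card_ne_zero_of_mem hl'
  · rw [partProd, hle]

theorem mk_monomial_eq_zero {φ : JetAlgebra relB →ₗ[ℂ] ℂ} {m : ℕ}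
    (hφ : ∀ p ∈ partIndex m, φ (partProd p) = 0) (e : Fin 4 × ℕ →₀ ℕ)
    (he : Finsupp.weight (fun p : Fin 4 × ℕ => p.2 + 1) e = m) :
    φ (Ideal.Quotient.mk (jetIdeal relB) (MvPolynomial.monomial e 1)) = 0 := by
  -- One index per factor, with multiplicity. The variable x_{ε₂} gets kind 4, since kind 2 is its
  -- square.
  let kind : (Σ p : e.support, Fin (e p)) → Fin 5 := fun x => ![0, 1, 4, 3] x.1.1.1
  have hkind : ∀ a : Fin 4, kindSeries (genSeries relB) (![0, 1, 4, 3] a) = genSeries relB a := by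
    intro a
    fin_cases a <;> rfl
  have hweight : ∀ a : Fin 4, kindWeight (![0, 1, 4, 3] a) = 1 := by decide
  have h := vanishesOn_kindSeries (g := genSeries relB) (φ := φ) (m := m)
    (fun f hf => aeval_genSeries relB hf)
    (fun n e' hanti hsum => by
      obtain ⟨p, hp, hpe⟩ := exists_partProd_eq e' hanti hsum
      rw [← hpe]
      exact hφ p hp) _ (Σ p : e.support, Fin (e p)) kind
    (∑ x : Σ p : e.support, Fin (e p), x.1.1.2) rfl (by
      rw [← he, ← Finset.sum_add_distrib, Finsupp.weight_apply, Finsupp.sum, Fintype.sum_sigma,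
        ← Finset.sum_coe_sort e.support fun p => e p • (p.2 + 1)]
      refine Finset.sum_congr rfl fun p _ => ?_
      simp [kind, hweight]) (fun x => x.1.1.2) rfl
  rw [← h]
  congr 1
  rw [MvPolynomial.monomial_eq, map_one, one_mul, Finsupp.prod, map_prod, Fintype.prod_sigma,
    ← Finset.prod_coe_sort e.support fun p =>
      Ideal.Quotient.mk (jetIdeal relB) (MvPolynomial.X p ^ e p)]
  refine Finset.prod_congr rfl fun p _ => ?_
  simp [kind, hkind, genSeries]

/-- A vector outside the span would be detected by a functional vanishing on the span, but such a
functional kills every monomial of weight `m`. -/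
theorem jetGraded_le_span [DecidableEq (JetAlgebra relB)] (m : ℕ) :
    jetGraded relB m ≤ Submodule.span ℂ (((partIndex m).image partProd : Finset _) : Set _) := by
  rintro _ ⟨f, hf, rfl⟩
  by_contra hnot
  obtain ⟨φ, hφf, hφ⟩ := Submodule.exists_le_ker_of_notMem hnot
  apply hφf
  have hφ' : ∀ p ∈ partIndex m, φ (partProd p) = 0 := fun p hp =>
    hφ (Submodule.subset_span (Finset.mem_coe.2 (Finset.mem_image_of_mem _ hp)))
  rw [f.as_sum, map_sum, map_sum]
  refine Finset.sum_eq_zero fun e he => ?_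
  have h : MvPolynomial.monomial e (f.coeff e) =
      f.coeff e • (MvPolynomial.monomial e 1 : JetPoly (Fin 4)) := by
    rw [MvPolynomial.smul_monomial, smul_eq_mul, mul_one]
  rw [h, map_smul, map_smul, smul_eq_mul]
  refine mul_eq_zero_of_right _ (mk_monomial_eq_zero hφ' e ?_)
  exact hf (MvPolynomial.mem_support_iff.1 he)

end HilbertSeries

end JetB2

theorem mainTheorem11 :
    (∀ m : ℕ, FiniteDimensional ℂ (JetB2.jetGraded JetB2.relB m)) ∧
    ∀ m : ℕ, PowerSeries.coeff m (JetB2.jetHilbertSeries JetB2.relB) ≤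
      PowerSeries.coeff m JetB2.fermSum := by
  classical
  have hfin := fun m => FiniteDimensional.span_finset ℂ
    ((JetB2.partIndex m).image JetB2.partProd : Finset (JetB2.JetAlgebra JetB2.relB))
  refine ⟨fun m => Submodule.finiteDimensional_of_le (JetB2.jetGraded_le_span m), fun m => ?_⟩
  rw [← JetB2.card_partIndex, JetB2.jetHilbertSeries, PowerSeries.coeff_mk, Nat.cast_le]
  exact ((Submodule.finrank_mono (JetB2.jetGraded_le_span m)).trans
    (finrank_span_finset_le_card _)).trans Finset.card_image_le
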